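/- Let $\mathbb{H}=\{z\in\mathbb{C}:\operatorname{Im} z>0\}$ and, for $\alpha>0$ and $z\in\mathbb{H}$, let $$\mathcal{K}(\alpha;z)=\sum_{(m,n)\in\mathbb{Z}^2}\frac{|mz+n|^2}{\operatorname{Im}(z)}\,e^{-\pi\alpha\frac{|mz+n|^2}{\operatorname{Im}(z)}},\qquad \Gamma_c=\Big\{z\in\mathbb{H}:\operatorname{Re}(z)=\tfrac12,\ \operatorname{Im}(z)\ge\tfrac{\sqrt3}{2}\Big\}.$$ Let $\alpha\ge 2$. Then: (1) For every real $b\ge 2\sqrt2$, the function $z\mapsto \mathcal{K}(\alpha;z)-b\,\mathcal{K}(2\alpha;z)$ has no minimizer on $\mathbb{H}$, i.e. there is no $z_0\in\mathbb{H}$ with $\mathcal{K}(\alpha;z_0)-b\,\mathcal{K}(2\alpha;z_0)\le \mathcal{K}(\alpha;z)-b\,\mathcal{K}(2\alpha;z)$ for all $z\in\mathbb{H}$. (2) For every real $b>2\sqrt2$, $\mathcal{K}(\alpha;z)-b\,\mathcal{K}(2\alpha;z)\to-\infty$ as $\operatorname{Im}(z)\to+\infty$, uniformly in $\operatorname{Re}(z)$.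 (3) For $b=2\sqrt2$, $\mathcal{K}(\alpha;z)-2\sqrt2\,\mathcal{K}(2\alpha;z)\to 0^+$ as $\operatorname{Im}(z)\to+\infty$, uniformly in $\operatorname{Re}(z)$ (that is, it tends to $0$ and is strictly positive once $\operatorname{Im}(z)$ is large enough), and $\mathcal{K}(\alpha;z)-2\sqrt2\,\mathcal{K}(2\alpha;z)>0$ for all $z\in\Gamma_c$. -/

import Mathlib

open UpperHalfPlane Filter Topology

/-- Squared length `|mz + n|² / Im z` of the point with integer coordinates `p = (m, n)` of the
unit-density lattice `(Im z)^(-1/2) (ℤ ⊕ zℤ)`. -/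
noncomputable def latticeNormSq (z : ℍ) (p : ℤ × ℤ) : ℝ :=
  ‖(p.1 : ℂ) * (z : ℂ) + (p.2 : ℂ)‖ ^ 2 / z.im

/-- `𝒦(α; z) = ∑_{(m,n) ∈ ℤ²} |mz+n|²/Im z · exp(-π α |mz+n|²/Im z)`. The family is summable
whenever `0 < α`, see `summable_latticeK`. -/
noncomputable def latticeK (α : ℝ) (z : ℍ) : ℝ :=
  ∑' p : ℤ × ℤ, latticeNormSq z p * Real.exp (-(Real.pi * α * latticeNormSq z p))

/-- The lattice energy `𝒦(α; z) - b 𝒦(2α; z)`. -/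
noncomputable def latticeEnergy (α b : ℝ) (z : ℍ) : ℝ :=
  latticeK α z - b * latticeK (2 * α) z

/-- The vertical half-line `Γ_c = {z ∈ ℍ : Re z = 1/2, Im z ≥ √3/2}`. -/
def GammaC : Set ℍ := {z | z.re = 1 / 2 ∧ Real.sqrt 3 / 2 ≤ z.im}

/-- The series defining `latticeK` converges, so its `tsum` is a genuine sum. -/
theorem summable_latticeK {α : ℝ} (hα : 0 < α) (z : ℍ) :
    Summable fun p : ℤ × ℤ =>
      latticeNormSq z p * Real.exp (-(Real.pi * α * latticeNormSq z p)) := by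
  have h0 : Summable fun v : Fin 2 → ℤ => ‖(v 0 : ℂ) * (z : ℂ) + (v 1 : ℂ)‖⁻¹ ^ 4 := by
    have h := EisensteinSeries.summable_norm_eisSummand (k := 4) (by norm_num) z
    refine h.congr fun v => ?_
    simp [EisensteinSeries.eisSummand, zpow_neg]
  have h1 : Summable fun p : ℤ × ℤ => ‖(p.1 : ℂ) * (z : ℂ) + (p.2 : ℂ)‖⁻¹ ^ 4 := by
    have h := (finTwoArrowEquiv ℤ).symm.summable_iff.mpr h0
    refine h.congr fun p => ?_
    simp [finTwoArrowEquiv]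
  have hz := z.im_pos
  have hc : 0 < Real.pi * α := mul_pos Real.pi_pos hα
  refine Summable.of_nonneg_of_le (fun p => ?_) (fun p => ?_)
    (h1.mul_left (6 / (Real.pi * α) ^ 3 * z.im ^ 2))
  · unfold latticeNormSq
    positivity
  · unfold latticeNormSq
    set r := ‖(p.1 : ℂ) * (z : ℂ) + (p.2 : ℂ)‖ with hr
    rcases (norm_nonneg ((p.1 : ℂ) * (z : ℂ) + (p.2 : ℂ))).eq_or_lt with h | h
    · rw [← hr] at h
      simp [← h]
    · rw [← hr] at h
      have ht : 0 < r ^ 2 / z.im := by positivity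
      have he := Real.pow_div_factorial_le_exp (Real.pi * α * (r ^ 2 / z.im)) (by positivity) 3
      have h6 : ((Nat.factorial 3 : ℕ) : ℝ) = 6 := by norm_num [Nat.factorial]
      rw [h6] at he
      have hpos : 0 < (Real.pi * α * (r ^ 2 / z.im)) ^ 3 / 6 := by positivity
      rw [Real.exp_neg]
      calc r ^ 2 / z.im * (Real.exp (Real.pi * α * (r ^ 2 / z.im)))⁻¹
          ≤ r ^ 2 / z.im * ((Real.pi * α * (r ^ 2 / z.im)) ^ 3 / 6)⁻¹ := by gcongr
        _ = 6 / (Real.pi * α) ^ 3 * z.im ^ 2 * r⁻¹ ^ 4 := by field_simp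

/-
For `α > 0`, `𝒦(α; z)` is `-1/π` times the derivative at `α` of the theta function of the lattice
`ℤ ⊕ zℤ`. If a theta function has an inversion formula of weight `d`, its first moment `M` satisfies
`2^(d+1) M(2t) < M(t)` for large `t`, term by term, and for small `t`, term by term after inversion;
for Jacobi's function (`d = 1/2`) the two ranges cover all `t > 0`. At the cusp only the row `m = 0`
survives, and there `𝒦(α; z) ≈ √(Im z) / (2π α^(3/2))`, so the leading terms cancel exactly at
`b = 2^(3/2)`. By `SL(2, ℤ)`-invariance, positivity at `b = 2^(3/2)` only has to be shown for
`Im z ≥ √3/2`. If `α Im z ≥ 1/2`, the row `m = 0` is handled by Jacobi's function and the other rows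
term by term; if `α Im z ≤ 1/2`, inversion of the whole lattice (`d = 1`) gives the constant `4`.
-/

section GaussianFamily

variable {ι κ : Type*} {q : ι → ℝ} {q' : κ → ℝ} {s t : ℝ}

/-- The theta function `∑ i, exp (-π t qᵢ)` of a family of squared lengths `q`. -/
noncomputable def gaussianSum (q : ι → ℝ) (t : ℝ) : ℝ :=
  ∑' i, Real.exp (-(Real.pi * t * q i))

/-- The first moment `∑ i, qᵢ exp (-π t qᵢ)`, which is `-1 / π` times the derivative of
`gaussianSum q`. -/
noncomputable def gaussianMoment (q : ι → ℝ) (t : ℝ) : ℝ :=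
  ∑' i, q i * Real.exp (-(Real.pi * t * q i))

/-- Families of squared lengths whose theta function converges at every positive time. -/
structure GaussianSummable (q : ι → ℝ) : Prop where
  nonneg : ∀ i, 0 ≤ q i
  summable_exp : ∀ ⦃t : ℝ⦄, 0 < t → Summable fun i => Real.exp (-(Real.pi * t * q i))

/-- The theta functions of `q` and `q'` are exchanged by `t ↦ t⁻¹` with weight `d`; Poisson
summation gives this for a unimodular lattice of rank `2 * d` and its dual. -/
def IsThetaDual (d : ℝ) (q : ι → ℝ) (q' : κ → ℝ) : Prop :=
  ∀ t : ℝ, 0 < t → gaussianSum q t⁻¹ = t ^ d * gaussianSum q' t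

theorem mul_exp_neg_le {x : ℝ} (ht : 0 < t) :
    x * Real.exp (-(Real.pi * t * x)) ≤
      2 / (Real.pi * t) * Real.exp (-(Real.pi * (t / 2) * x)) := by
  have hle : Real.pi * t / 2 * x ≤ Real.exp (Real.pi * t / 2 * x) := by
    linarith [Real.add_one_le_exp (Real.pi * t / 2 * x)]
  have hsplit : Real.exp (-(Real.pi * (t / 2) * x)) =
      Real.exp (Real.pi * t / 2 * x) * Real.exp (-(Real.pi * t * x)) := by
    rw [← Real.exp_add]
    ring_nf
  calc x * Real.exp (-(Real.pi * t * x))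
      = 2 / (Real.pi * t) * (Real.pi * t / 2 * x * Real.exp (-(Real.pi * t * x))) := by
        field_simp
    _ ≤ _ := by rw [hsplit]; gcongr

theorem sub_mul_exp_neg_lt {d s : ℝ} (hs : 0 < s) (hds : d + 1 ≤ s) :
    (d - s) * Real.exp (-s) < (d - 2 * s) * Real.exp (-(2 * s)) := by
  have hexp : Real.exp (-s) = Real.exp s * Real.exp (-(2 * s)) := by
    rw [← Real.exp_add]
    ring_nf
  have hlin := Real.add_one_lt_exp hs.ne'
  rw [hexp, ← mul_assoc]
  gcongr
  nlinarith

theorem gaussianSum_nonneg (q : ι → ℝ) (t : ℝ) : 0 ≤ gaussianSum q t :=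
  tsum_nonneg fun _ => (Real.exp_pos _).le

namespace GaussianSummable

theorem summable_moment (hq : GaussianSummable q) (ht : 0 < t) :
    Summable fun i => q i * Real.exp (-(Real.pi * t * q i)) :=
  ((hq.summable_exp (half_pos ht)).mul_left _).of_nonneg_of_le
    (fun i => mul_nonneg (hq.nonneg i) (Real.exp_pos _).le) fun _ => mul_exp_neg_le ht

theorem comp_injective (hq : GaussianSummable q) {f : κ → ι} (hf : Function.Injective f) :
    GaussianSummable (q ∘ f) :=
  ⟨fun k => hq.nonneg (f k), fun _ ht => (hq.summable_exp ht).comp_injective hf⟩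

theorem gaussianMoment_nonneg (hq : GaussianSummable q) (t : ℝ) : 0 ≤ gaussianMoment q t :=
  tsum_nonneg fun i => mul_nonneg (hq.nonneg i) (Real.exp_pos _).le

theorem gaussianMoment_comp_le (hq : GaussianSummable q) {f : κ → ι} (hf : Function.Injective f)
    (ht : 0 < t) : gaussianMoment (q ∘ f) t ≤ gaussianMoment q t :=
  (hq.comp_injective hf).summable_moment ht |>.tsum_le_tsum_of_inj f hf
    (fun i _ => mul_nonneg (hq.nonneg i) (Real.exp_pos _).le) (fun _ => le_rfl)
    (hq.summable_moment ht)

theorem gaussianMoment_le_gaussianSum (hq : GaussianSummable q) (ht : 0 < t) :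
    gaussianMoment q t ≤ 2 / (Real.pi * t) * gaussianSum q (t / 2) := by
  rw [gaussianSum, ← tsum_mul_left]
  exact (hq.summable_moment ht).tsum_le_tsum (fun _ => mul_exp_neg_le ht)
    ((hq.summable_exp (half_pos ht)).mul_left _)

theorem gaussianSum_antitoneOn (hq : GaussianSummable q) :
    AntitoneOn (gaussianSum q) (Set.Ioi 0) := by
  intro s hs t ht hst
  refine (hq.summable_exp ht).tsum_le_tsum (fun i => ?_) (hq.summable_exp hs)
  have := hq.nonneg i
  gcongr

theorem gaussianMoment_le_exp_mul (hq : GaussianSummable q) {δ : ℝ}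
    (hδ : ∀ i, q i ≠ 0 → δ ≤ q i) (hs : 0 < s) (hst : s ≤ t) :
    gaussianMoment q t ≤ Real.exp (-(Real.pi * (t - s) * δ)) * gaussianMoment q s := by
  rw [gaussianMoment, gaussianMoment, ← tsum_mul_left]
  refine (hq.summable_moment (hs.trans_le hst)).tsum_le_tsum (fun i => ?_)
    ((hq.summable_moment hs).mul_left _)
  rcases eq_or_ne (q i) 0 with h0 | h0
  · simp [h0]
  · have hexp : Real.exp (-(Real.pi * t * q i)) =
        Real.exp (-(Real.pi * (t - s) * q i)) * Real.exp (-(Real.pi * s * q i)) := by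
      rw [← Real.exp_add]
      ring_nf
    have := sub_nonneg.mpr hst
    have := hδ i h0
    have := hq.nonneg i
    rw [hexp, mul_left_comm]
    gcongr

theorem tendsto_rpow_mul_gaussianMoment (hq : GaussianSummable q) {δ : ℝ} (hδ0 : 0 < δ)
    (hδ : ∀ i, q i ≠ 0 → δ ≤ q i) (r : ℝ) :
    Tendsto (fun t => t ^ r * gaussianMoment q t) atTop (𝓝 0) := by
  have hdecay := (tendsto_rpow_mul_exp_neg_mul_atTop_nhds_zero r (Real.pi * δ)
    (by positivity)).mul_const (Real.exp (Real.pi * δ) * gaussianMoment q 1)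
  rw [zero_mul] at hdecay
  refine squeeze_zero' ?_ ?_ hdecay <;> filter_upwards [eventually_ge_atTop 1] with t ht
  · have := hq.gaussianMoment_nonneg t
    positivity
  · calc t ^ r * gaussianMoment q t
        ≤ t ^ r * (Real.exp (-(Real.pi * (t - 1) * δ)) * gaussianMoment q 1) := by
          gcongr
          exact hq.gaussianMoment_le_exp_mul hδ one_pos ht
      _ = _ := by
          rw [show -(Real.pi * (t - 1) * δ) = -(Real.pi * δ) * t + Real.pi * δ by ring,
            Real.exp_add]
          ring

theorem hasDerivAt_gaussianSum (hq : GaussianSummable q) (ht : 0 < t) :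
    HasDerivAt (gaussianSum q) (-(Real.pi * gaussianMoment q t)) t := by
  rw [gaussianMoment, ← tsum_mul_left, ← tsum_neg]
  refine hasDerivAt_tsum_of_isPreconnected (t := Set.Ioi (t / 2)) (y₀ := t) (y := t)
    (g := fun i s => Real.exp (-(Real.pi * s * q i)))
    (g' := fun i s => -(Real.pi * (q i * Real.exp (-(Real.pi * s * q i)))))
    ((hq.summable_moment (half_pos ht)).mul_left Real.pi) isOpen_Ioi isPreconnected_Ioi
    (fun i s _ => ?_) (fun i s hs => ?_) (half_lt_self ht) (hq.summable_exp ht)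
    (half_lt_self ht)
  · have hlin : HasDerivAt (fun s => -(Real.pi * s * q i)) (-(Real.pi * 1 * q i)) s :=
      (((hasDerivAt_id s).const_mul Real.pi).mul_const (q i)).neg
    exact hlin.exp.congr_deriv (by ring)
  · have hqi := hq.nonneg i
    have hts : t / 2 < s := hs
    rw [norm_neg, Real.norm_of_nonneg (by positivity)]
    gcongr

theorem mul_gaussianMoment_two_mul_lt (hq : GaussianSummable q) {a : ℝ} (ha : 0 < a) (ht : 0 < t)
    (hlog : ∀ i, q i ≠ 0 → Real.log a < Real.pi * t * q i) (hne : ∃ i, q i ≠ 0) :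
    a * gaussianMoment q (2 * t) < gaussianMoment q t := by
  have hterm (i : ι) (hi : q i ≠ 0) : a * (q i * Real.exp (-(Real.pi * (2 * t) * q i))) <
      q i * Real.exp (-(Real.pi * t * q i)) := by
    have hpos : 0 < q i := (hq.nonneg i).lt_of_ne' hi
    have hexp : a * Real.exp (-(Real.pi * (2 * t) * q i)) < Real.exp (-(Real.pi * t * q i)) := by
      rw [← Real.exp_log ha, ← Real.exp_add, Real.exp_lt_exp]
      linarith [hlog i hi]
    rw [mul_left_comm]
    gcongr
  obtain ⟨i₀, hi₀⟩ := hne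
  rw [gaussianMoment, ← tsum_mul_left]
  refine Summable.tsum_lt_tsum (fun i => ?_) (hterm i₀ hi₀)
    ((hq.summable_moment (by positivity)).mul_left a) (hq.summable_moment ht)
  rcases eq_or_ne (q i) 0 with h0 | h0
  · simp [h0]
  · exact (hterm i h0).le

end GaussianSummable

namespace IsThetaDual

theorem pi_mul_gaussianMoment_inv {d : ℝ} (hdual : IsThetaDual d q q') (hq : GaussianSummable q)
    (hq' : GaussianSummable q') (ht : 0 < t) :
    Real.pi * gaussianMoment q t⁻¹ =
      t ^ (d + 1) * (d * gaussianSum q' t - Real.pi * t * gaussianMoment q' t) := by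
  have hleft : HasDerivAt (fun s => gaussianSum q s⁻¹)
      (-(Real.pi * gaussianMoment q t⁻¹) * (-(t ^ 2)⁻¹)) t :=
    (hq.hasDerivAt_gaussianSum (inv_pos.mpr ht)).comp t (hasDerivAt_inv ht.ne')
  have hright : HasDerivAt (fun s => s ^ d * gaussianSum q' s)
      (d * t ^ (d - 1) * gaussianSum q' t + t ^ d * -(Real.pi * gaussianMoment q' t)) t :=
    (Real.hasDerivAt_rpow_const (Or.inl ht.ne')).mul (hq'.hasDerivAt_gaussianSum ht)
  have heq : (fun s => gaussianSum q s⁻¹) =ᶠ[𝓝 t] fun s => s ^ d * gaussianSum q' s := by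
    filter_upwards [lt_mem_nhds ht] with s hs using hdual s hs
  have hderiv := hleft.unique (hright.congr_of_eventuallyEq heq)
  rw [Real.rpow_sub_one ht.ne'] at hderiv
  rw [Real.rpow_add_one ht.ne']
  field_simp at hderiv
  rw [one_div] at hderiv
  linear_combination hderiv

theorem two_rpow_mul_gaussianMoment_two_mul_lt {d : ℝ} (hdual : IsThetaDual d q q')
    (hq : GaussianSummable q) (hq' : GaussianSummable q') (ht : 0 < t)
    (hlarge : ∀ k, q' k ≠ 0 → d + 1 ≤ Real.pi * q' k / (2 * t)) (hne : ∃ k, q' k ≠ 0) :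
    2 ^ (d + 1) * gaussianMoment q (2 * t) < gaussianMoment q t := by
  have hsum {s : ℝ} (hs : 0 < s) :
      HasSum (fun k => (d - Real.pi * s * q' k) * Real.exp (-(Real.pi * s * q' k)))
        (d * gaussianSum q' s - Real.pi * s * gaussianMoment q' s) := by
    refine (((hq'.summable_exp hs).hasSum.mul_left d).sub
      ((hq'.summable_moment hs).hasSum.mul_left (Real.pi * s))).congr_fun fun k => ?_
    ring
  have hterm (k : κ) (hk : q' k ≠ 0) :
      (d - Real.pi * (t⁻¹ / 2) * q' k) * Real.exp (-(Real.pi * (t⁻¹ / 2) * q' k)) <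
        (d - Real.pi * t⁻¹ * q' k) * Real.exp (-(Real.pi * t⁻¹ * q' k)) := by
    have hpos : 0 < q' k := (hq'.nonneg k).lt_of_ne' hk
    have := sub_mul_exp_neg_lt (by positivity) (hlarge k hk)
    convert this using 3 <;> field_simp
  obtain ⟨k₀, hk₀⟩ := hne
  have hlt := hasSum_lt (fun k => ?_) (hterm k₀ hk₀) (hsum (half_pos (inv_pos.mpr ht)))
    (hsum (inv_pos.mpr ht))
  · have hinv := hdual.pi_mul_gaussianMoment_inv hq hq' (inv_pos.mpr ht)
    have hinv_half := hdual.pi_mul_gaussianMoment_inv hq hq' (half_pos (inv_pos.mpr ht))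
    rw [inv_div, div_inv_eq_mul] at hinv_half
    rw [inv_inv] at hinv
    rw [← mul_lt_mul_iff_right₀ Real.pi_pos, mul_left_comm, hinv, hinv_half, ← mul_assoc,
      ← Real.mul_rpow two_pos.le (by positivity), mul_div_cancel₀ _ two_ne_zero]
    gcongr
  · rcases eq_or_ne (q' k) 0 with h0 | h0
    · simp [h0]
    · exact (hterm k h0).le

end IsThetaDual

end GaussianFamily

section IntegerSquares

/-- The squared lengths `n²` of the lattice `ℤ`, whose theta function is Jacobi's. -/
def intSq (n : ℤ) : ℝ :=
  (n : ℝ) ^ 2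

theorem one_le_intSq {n : ℤ} (hn : n ≠ 0) : 1 ≤ intSq n := by
  rw [intSq, ← sq_abs]
  exact one_le_pow₀ (by exact_mod_cast Int.one_le_abs hn)

theorem one_le_intSq_of_ne_zero {n : ℤ} (hn : intSq n ≠ 0) : 1 ≤ intSq n :=
  one_le_intSq (by rintro rfl; simp [intSq] at hn)

theorem gaussianSummable_intSq : GaussianSummable intSq where
  nonneg n := sq_nonneg _
  summable_exp t ht := by
    refine (summable_pow_mul_jacobiTheta₂_term_bound 0 ht 0).congr fun n => ?_
    simp [intSq, mul_assoc]

theorem isThetaDual_intSq : IsThetaDual (1 / 2) intSq intSq := by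
  intro t ht
  have hpoisson : gaussianSum intSq t = 1 / t ^ (1 / 2 : ℝ) * gaussianSum intSq t⁻¹ := by
    simpa only [gaussianSum, intSq, neg_mul, neg_div, div_eq_mul_inv] using
      Real.tsum_exp_neg_mul_int_sq ht
  rw [hpoisson]
  field_simp

theorem log_two_mul_sqrt_two_lt : Real.log (2 * √2) < 3 / 2 := by
  rw [Real.log_mul two_ne_zero (by positivity), Real.log_sqrt two_pos.le]
  linarith [Real.log_two_lt_d9]

theorem gaussianMoment_intSq_doubling_lt {t : ℝ} (ht : 0 < t) :
    2 * √2 * gaussianMoment intSq (2 * t) < gaussianMoment intSq t := by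
  have hne : ∃ n, intSq n ≠ 0 := ⟨1, by simp [intSq]⟩
  have hpi := Real.pi_gt_three
  rcases le_total 1 t with h | h
  · refine gaussianSummable_intSq.mul_gaussianMoment_two_mul_lt (by positivity) ht
      (fun n hn => log_two_mul_sqrt_two_lt.trans ?_) hne
    calc (3 / 2 : ℝ) < 3 * 1 * 1 := by norm_num
      _ ≤ Real.pi * t * intSq n := by gcongr; exact one_le_intSq_of_ne_zero hn
  · have hpow : (2 : ℝ) ^ (1 / 2 + 1 : ℝ) = 2 * √2 := by
      rw [Real.rpow_add_one two_ne_zero, ← Real.sqrt_eq_rpow, mul_comm]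
    rw [← hpow]
    refine isThetaDual_intSq.two_rpow_mul_gaussianMoment_two_mul_lt gaussianSummable_intSq
      gaussianSummable_intSq ht (fun n hn => ?_) hne
    calc (1 / 2 + 1 : ℝ) = 3 * 1 / (2 * 1) := by norm_num
      _ ≤ Real.pi * intSq n / (2 * t) := by
        have := gaussianSummable_intSq.nonneg n
        gcongr
        exact one_le_intSq_of_ne_zero hn

theorem gaussianSum_intSq_sub_one_mem_Icc {t : ℝ} (ht : 0 < t) :
    gaussianSum intSq t - 1 ∈ Set.Icc 0 (gaussianMoment intSq t) := by
  have hsub := (gaussianSummable_intSq.summable_exp ht).hasSum.sub (hasSum_ite_eq (0 : ℤ) 1)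
  refine ⟨hsub.nonneg fun n => ?_,
    hasSum_le (fun n => ?_) hsub (gaussianSummable_intSq.summable_moment ht).hasSum⟩ <;>
  rcases eq_or_ne n 0 with rfl | hn
  · simp [intSq]
  · simpa [hn] using (Real.exp_pos _).le
  · simp [intSq]
  · simpa [hn] using le_mul_of_one_le_left (Real.exp_pos _).le (one_le_intSq hn)

theorem tendsto_gaussianMoment_intSq_inv_div :
    Tendsto (fun t => gaussianMoment intSq t⁻¹ / t - √t / (2 * Real.pi)) atTop (𝓝 0) := by
  have hmoment (r : ℝ) : Tendsto (fun t => t ^ r * gaussianMoment intSq t) atTop (𝓝 0) :=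
    gaussianSummable_intSq.tendsto_rpow_mul_gaussianMoment one_pos
      (fun _ => one_le_intSq_of_ne_zero) r
  have hsum : Tendsto (fun t => t ^ (1 / 2 : ℝ) * (gaussianSum intSq t - 1)) atTop (𝓝 0) := by
    refine squeeze_zero' ?_ ?_ (hmoment (1 / 2)) <;>
    filter_upwards [eventually_gt_atTop 0] with t ht <;>
    obtain ⟨hlo, hhi⟩ := gaussianSum_intSq_sub_one_mem_Icc ht
    · positivity
    · gcongr
  have hlim := (hsum.div_const (2 * Real.pi)).sub (hmoment (1 / 2 + 1))
  rw [zero_div, sub_zero] at hlim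
  refine hlim.congr' ?_
  filter_upwards [eventually_gt_atTop 0] with t ht
  have hinv := isThetaDual_intSq.pi_mul_gaussianMoment_inv gaussianSummable_intSq
    gaussianSummable_intSq ht
  rw [Real.rpow_add_one ht.ne'] at hinv ⊢
  rw [Real.sqrt_eq_rpow]
  field_simp
  rw [one_div t]
  linear_combination -2 * hinv

end IntegerSquares

section LatticeNorm

theorem latticeNormSq_eq_add (z : ℍ) (p : ℤ × ℤ) :
    latticeNormSq z p = (p.1 : ℝ) ^ 2 * z.im + (p.1 * z.re + p.2) ^ 2 / z.im := by
  have hz := z.im_ne_zero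
  rw [latticeNormSq, ← Complex.normSq_eq_norm_sq, Complex.normSq_apply]
  simp only [Complex.add_re, Complex.mul_re, Complex.intCast_re, coe_re, Complex.intCast_im,
    zero_mul, sub_zero, Complex.add_im, Complex.mul_im, coe_im, add_zero]
  field_simp
  ring

theorem latticeNormSq_nonneg (z : ℍ) (p : ℤ × ℤ) : 0 ≤ latticeNormSq z p :=
  div_nonneg (sq_nonneg _) z.im_pos.le

theorem latticeNormSq_zero_left (z : ℍ) (n : ℤ) : latticeNormSq z (0, n) = intSq n / z.im := by
  simp [latticeNormSq, intSq]

theorem im_le_latticeNormSq (z : ℍ) {p : ℤ × ℤ} (hp : p.1 ≠ 0) : z.im ≤ latticeNormSq z p := by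
  have hz := z.im_pos
  rw [latticeNormSq_eq_add]
  calc z.im ≤ (p.1 : ℝ) ^ 2 * z.im := le_mul_of_one_le_left hz.le (one_le_intSq hp)
    _ ≤ _ := le_add_of_nonneg_right (by positivity)

theorem min_im_inv_le_latticeNormSq (z : ℍ) {p : ℤ × ℤ} (hp : p ≠ 0) :
    min z.im z.im⁻¹ ≤ latticeNormSq z p := by
  obtain ⟨m, n⟩ := p
  rcases eq_or_ne m 0 with rfl | hm
  · have hn : n ≠ 0 := by simpa using hp
    rw [latticeNormSq_zero_left, ← one_div]
    exact (min_le_right _ _).trans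
      (div_le_div_of_nonneg_right (one_le_intSq hn) z.im_pos.le)
  · exact (min_le_left _ _).trans (im_le_latticeNormSq z hm)

theorem gaussianSummable_latticeNormSq (z : ℍ) : GaussianSummable (latticeNormSq z) where
  nonneg := latticeNormSq_nonneg z
  summable_exp t ht := by
    set δ := min z.im z.im⁻¹
    have hδ : 0 < δ := lt_min z.im_pos (inv_pos.mpr z.im_pos)
    refine Summable.of_norm_bounded_eventually ((summable_latticeK ht z).mul_left δ⁻¹) ?_
    filter_upwards [(Set.finite_singleton (0 : ℤ × ℤ)).compl_mem_cofinite] with p hp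
    rw [Real.norm_of_nonneg (Real.exp_pos _).le, ← mul_assoc]
    refine le_mul_of_one_le_left (Real.exp_pos _).le ?_
    rw [← div_eq_inv_mul, one_le_div hδ]
    exact min_im_inv_le_latticeNormSq z hp

end LatticeNorm

section ModularInvariance

/-- The change of lattice coordinates `p ↦ p g` induced by `g ∈ SL(2, ℤ)`. -/
def latticeCoordEquiv (g : Matrix.SpecialLinearGroup (Fin 2) ℤ) : ℤ × ℤ ≃ ℤ × ℤ where
  toFun p := (p.1 * g 0 0 + p.2 * g 1 0, p.1 * g 0 1 + p.2 * g 1 1)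
  invFun p := (p.1 * g 1 1 - p.2 * g 1 0, p.2 * g 0 0 - p.1 * g 0 1)
  left_inv p := by
    have hdet := g.det_coe
    rw [Matrix.det_fin_two] at hdet
    ext
    · linear_combination p.1 * hdet
    · linear_combination p.2 * hdet
  right_inv p := by
    have hdet := g.det_coe
    rw [Matrix.det_fin_two] at hdet
    ext
    · linear_combination p.1 * hdet
    · linear_combination p.2 * hdet

theorem latticeNormSq_smul (g : Matrix.SpecialLinearGroup (Fin 2) ℤ) (z : ℍ) (p : ℤ × ℤ) :
    latticeNormSq (g • z) p = latticeNormSq z (latticeCoordEquiv g p) := by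
  have hdenom : (g 1 0 : ℂ) * z + g 1 1 ≠ 0 := by
    simpa [ModularGroup.denom_apply] using denom_ne_zero g z
  have him : (g • z).im = z.im / ‖(g 1 0 : ℂ) * z + g 1 1‖ ^ 2 := by
    rw [ModularGroup.im_smul_eq_div_normSq, ModularGroup.denom_apply, Complex.normSq_eq_norm_sq]
  have hvec : (p.1 : ℂ) * ↑(g • z) + p.2 =
      ((latticeCoordEquiv g p).1 * z + (latticeCoordEquiv g p).2) / ((g 1 0 : ℂ) * z + g 1 1) := by
    rw [coe_specialLinearGroup_apply]
    simp only [latticeCoordEquiv, Equiv.coe_fn_mk, algebraMap_int_eq, eq_intCast,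
      Complex.ofReal_intCast, Int.cast_add, Int.cast_mul]
    rw [eq_div_iff hdenom, add_mul, mul_assoc, div_mul_cancel₀ _ hdenom]
    ring
  have hz := z.im_ne_zero
  have hnorm := norm_ne_zero_iff.mpr hdenom
  rw [latticeNormSq, latticeNormSq, hvec, him, norm_div]
  generalize ‖(g 1 0 : ℂ) * z + g 1 1‖ = r at *
  field_simp

theorem latticeEnergy_smul (α b : ℝ) (g : Matrix.SpecialLinearGroup (Fin 2) ℤ) (z : ℍ) :
    latticeEnergy α b (g • z) = latticeEnergy α b z := by
  have hK (α : ℝ) : latticeK α (g • z) = latticeK α z := by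
    simp only [latticeK, latticeNormSq_smul]
    exact (latticeCoordEquiv g).tsum_eq fun p =>
      latticeNormSq z p * Real.exp (-(Real.pi * α * latticeNormSq z p))
  simp only [latticeEnergy, hK]

end ModularInvariance

section PoissonSummation

/-- The summand `exp (-π a m² - π b n² - 2π i x m n)` of `phaseSum`, at `p = (m, n)`. -/
noncomputable def phaseTerm (x a b : ℝ) (p : ℤ × ℤ) : ℂ :=
  Complex.exp (-(Real.pi * a * intSq p.1 + Real.pi * b * intSq p.2 : ℝ) -
    2 * Real.pi * Complex.I * x * p.1 * p.2)

/-- The double sum `∑ exp (-π a m² - π b n² - 2π i x m n)` over `(m, n) ∈ ℤ²`. Poisson summation in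
either coordinate turns it into the theta function of the lattice `ℤ ⊕ zℤ`. -/
noncomputable def phaseSum (x a b : ℝ) : ℂ :=
  ∑' p : ℤ × ℤ, phaseTerm x a b p

theorem phaseSum_comm (x a b : ℝ) : phaseSum x a b = phaseSum x b a := by
  rw [phaseSum, ← (Equiv.prodComm ℤ ℤ).tsum_eq]
  refine tsum_congr fun p => ?_
  simp only [phaseTerm, Equiv.prodComm_apply, Prod.fst_swap, Prod.snd_swap]
  push_cast
  ring_nf

theorem norm_phaseTerm (x a b : ℝ) (p : ℤ × ℤ) :
    ‖phaseTerm x a b p‖ =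
      Real.exp (-(Real.pi * a * intSq p.1)) * Real.exp (-(Real.pi * b * intSq p.2)) := by
  rw [phaseTerm, Complex.norm_exp, ← Real.exp_add]
  congr 1
  simp only [Complex.ofReal_add, Complex.ofReal_mul, neg_add_rev, Complex.sub_re, Complex.add_re,
    Complex.neg_re, Complex.mul_re, Complex.ofReal_re, Complex.ofReal_im, mul_zero, sub_zero,
    Complex.mul_im, zero_mul, add_zero, Complex.re_ofNat, Complex.im_ofNat, Complex.I_re,
    Complex.I_im, mul_one, sub_self, Complex.intCast_re, zero_add, Complex.intCast_im]
  ring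

theorem summable_norm_phaseTerm {a b : ℝ} (ha : 0 < a) (hb : 0 < b) (x : ℝ) :
    Summable fun p => ‖phaseTerm x a b p‖ := by
  simp only [norm_phaseTerm]
  exact (gaussianSummable_intSq.summable_exp ha).mul_of_nonneg
    (gaussianSummable_intSq.summable_exp hb) (fun _ => (Real.exp_pos _).le)
    fun _ => (Real.exp_pos _).le

theorem norm_phaseSum_le {a b : ℝ} (ha : 0 < a) (hb : 0 < b) (x : ℝ) :
    ‖phaseSum x a b‖ ≤ gaussianSum intSq a * gaussianSum intSq b := by
  refine (norm_tsum_le_tsum_norm (summable_norm_phaseTerm ha hb x)).trans_eq ?_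
  simp only [norm_phaseTerm]
  exact (tsum_mul_tsum_of_summable_norm (gaussianSummable_intSq.summable_exp ha).norm
    (gaussianSummable_intSq.summable_exp hb).norm).symm

theorem tsum_exp_latticeNormSq_row (z : ℍ) {t : ℝ} (ht : 0 < t) (m : ℤ) :
    ∑' n : ℤ, (Real.exp (-(Real.pi * t * latticeNormSq z (m, n))) : ℂ) =
      √(z.im / t) * ∑' n : ℤ, phaseTerm z.re (t * z.im) (z.im / t) (m, n) := by
  have hz := z.im_pos
  have hpoisson := Complex.tsum_exp_neg_quadratic (a := (z.im / t : ℝ))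
    (by simpa using div_pos hz ht) (-Complex.I * (m * z.re))
  have hphase (n : ℤ) : phaseTerm z.re (t * z.im) (z.im / t) (m, n) =
      Complex.exp (-(Real.pi * (t * z.im) * intSq m : ℝ)) * Complex.exp
        (-Real.pi * (z.im / t : ℝ) * n ^ 2 + 2 * Real.pi * (-Complex.I * (m * z.re)) * n) := by
    rw [phaseTerm, ← Complex.exp_add, intSq, intSq]
    push_cast
    ring_nf
  have hrow (n : ℤ) : (Real.exp (-(Real.pi * t * latticeNormSq z (m, n))) : ℂ) =
      Complex.exp (-(Real.pi * (t * z.im) * intSq m : ℝ)) * Complex.exp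
        (-Real.pi / (z.im / t : ℝ) * (n + Complex.I * (-Complex.I * (m * z.re))) ^ 2) := by
    have hI : Complex.I * (-Complex.I * (m * z.re)) = m * z.re := by
      rw [← mul_assoc, mul_neg, Complex.I_mul_I, neg_neg, one_mul]
    rw [hI, ← Complex.exp_add, latticeNormSq_eq_add, intSq]
    push_cast
    congr 1
    have : (z.im : ℂ) ≠ 0 := by exact_mod_cast hz.ne'
    have : (t : ℂ) ≠ 0 := by exact_mod_cast ht.ne'
    field_simp
    ring
  have hsqrt : (√(z.im / t) : ℂ) = ((z.im / t : ℝ) : ℂ) ^ (1 / 2 : ℂ) := by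
    rw [Real.sqrt_eq_rpow, Complex.ofReal_cpow (by positivity)]
    norm_num
  have hne : (√(z.im / t) : ℂ) ≠ 0 := by
    exact_mod_cast (Real.sqrt_pos.mpr (div_pos hz ht)).ne'
  simp_rw [hphase, hrow]
  rw [tsum_mul_left, tsum_mul_left, hpoisson, ← hsqrt]
  field_simp

theorem gaussianSum_latticeNormSq_eq (z : ℍ) {t : ℝ} (ht : 0 < t) :
    (gaussianSum (latticeNormSq z) t : ℂ) =
      √(z.im / t) * phaseSum z.re (t * z.im) (z.im / t) := by
  have hz := z.im_pos
  rw [gaussianSum, ((gaussianSummable_latticeNormSq z).summable_exp ht).tsum_prod,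
    Complex.ofReal_tsum, phaseSum,
    (summable_norm_phaseTerm (mul_pos ht hz) (div_pos hz ht) z.re).of_norm.tsum_prod,
    ← tsum_mul_left]
  refine tsum_congr fun m => ?_
  rw [Complex.ofReal_tsum, tsum_exp_latticeNormSq_row z ht]

theorem gaussianSum_latticeNormSq_le (z : ℍ) {t : ℝ} (ht : 0 < t) :
    gaussianSum (latticeNormSq z) t ≤
      √(z.im / t) * (gaussianSum intSq (t * z.im) * gaussianSum intSq (z.im / t)) := by
  have hz := z.im_pos
  calc gaussianSum (latticeNormSq z) t ≤ ‖(gaussianSum (latticeNormSq z) t : ℂ)‖ := by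
        rw [Complex.norm_real]
        exact le_abs_self _
    _ = √(z.im / t) * ‖phaseSum z.re (t * z.im) (z.im / t)‖ := by
        rw [gaussianSum_latticeNormSq_eq z ht, norm_mul,
          Complex.norm_of_nonneg (Real.sqrt_nonneg _)]
    _ ≤ _ := by
        gcongr
        exact norm_phaseSum_le (mul_pos ht hz) (div_pos hz ht) z.re

theorem isThetaDual_latticeNormSq (z : ℍ) :
    IsThetaDual 1 (latticeNormSq z) (latticeNormSq z) := by
  intro t ht
  have hsqrt : √(t * z.im) = t * √(z.im / t) := by
    rw [← Real.sqrt_sq ht.le, ← Real.sqrt_mul (sq_nonneg t)]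
    congr 1
    rw [Real.sqrt_sq ht.le]
    field_simp
  have hcomplex :
      (gaussianSum (latticeNormSq z) t⁻¹ : ℂ) = t * gaussianSum (latticeNormSq z) t := by
    rw [gaussianSum_latticeNormSq_eq z ht, gaussianSum_latticeNormSq_eq z (inv_pos.mpr ht),
      phaseSum_comm, div_inv_eq_mul, mul_comm z.im t, hsqrt, inv_mul_eq_div]
    push_cast
    ring
  rw [Real.rpow_one]
  exact_mod_cast hcomplex

end PoissonSummation

section CuspExpansion

/-- The squared lengths `|mz + n|² / Im z` with `m ≠ 0`, that is, of the vectors of the lattice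
`ℤ ⊕ zℤ` off the real axis. -/
noncomputable def offAxisNormSq (z : ℍ) : {p : ℤ × ℤ // p.1 ≠ 0} → ℝ :=
  latticeNormSq z ∘ Subtype.val

theorem im_le_offAxisNormSq (z : ℍ) (p : {p : ℤ × ℤ // p.1 ≠ 0}) : z.im ≤ offAxisNormSq z p :=
  im_le_latticeNormSq z p.2

theorem gaussianSummable_offAxisNormSq (z : ℍ) : GaussianSummable (offAxisNormSq z) :=
  (gaussianSummable_latticeNormSq z).comp_injective Subtype.val_injective

theorem latticeK_eq_gaussianMoment (α : ℝ) (z : ℍ) :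
    latticeK α z = gaussianMoment (latticeNormSq z) α :=
  rfl

theorem latticeK_eq_add {α : ℝ} (hα : 0 < α) (z : ℍ) :
    latticeK α z = gaussianMoment intSq (α / z.im) / z.im + gaussianMoment (offAxisNormSq z) α := by
  have hinj : Function.Injective fun n : ℤ => ((0, n) : ℤ × ℤ) := Prod.mk_right_injective 0
  have hrange : Set.range (fun n : ℤ => ((0, n) : ℤ × ℤ)) = {p | p.1 ≠ 0}ᶜ := by
    ext ⟨m, n⟩
    simp [eq_comm]
  have haxis : ∑' n : ℤ, latticeNormSq z (0, n) *
      Real.exp (-(Real.pi * α * latticeNormSq z (0, n))) =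
        gaussianMoment intSq (α / z.im) / z.im := by
    rw [gaussianMoment, ← tsum_div_const]
    refine tsum_congr fun n => ?_
    rw [latticeNormSq_zero_left]
    ring_nf
  rw [← haxis, latticeK,
    ← (summable_latticeK hα z).tsum_subtype_add_tsum_subtype_compl {p | p.1 ≠ 0}, ← hrange,
    add_comm]
  exact congrArg (· + _) (tsum_range (fun p =>
    latticeNormSq z p * Real.exp (-(Real.pi * α * latticeNormSq z p))) hinj)

theorem gaussianSum_latticeNormSq_le_of_one_le_im {t : ℝ} (ht : 0 < t) {z : ℍ} (hz : 1 ≤ z.im) :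
    gaussianSum (latticeNormSq z) t ≤
      √(z.im / t) * (gaussianSum intSq t * gaussianSum intSq t⁻¹) := by
  have htheta {s u : ℝ} (hs : 0 < s) (hsu : s ≤ u) : gaussianSum intSq u ≤ gaussianSum intSq s :=
    gaussianSummable_intSq.gaussianSum_antitoneOn hs (hs.trans_le hsu) hsu
  refine (gaussianSum_latticeNormSq_le z ht).trans ?_
  gcongr
  · exact gaussianSum_nonneg intSq _
  · exact gaussianSum_nonneg intSq t
  · exact htheta ht (le_mul_of_one_le_right ht.le hz)
  · exact htheta (inv_pos.mpr ht) (le_mul_of_one_le_left (inv_pos.mpr ht).le hz)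

theorem gaussianMoment_offAxisNormSq_le {α : ℝ} (hα : 0 < α) {z : ℍ} (hz : 1 ≤ z.im) :
    gaussianMoment (offAxisNormSq z) α ≤
      Real.exp (-(Real.pi * (α / 2) * z.im)) * (2 / (Real.pi * (α / 2)) *
        (√(z.im / (α / 4)) * (gaussianSum intSq (α / 4) * gaussianSum intSq (α / 4)⁻¹))) := by
  have hQ := gaussianSummable_latticeNormSq z
  have hquarter : α / 2 / 2 = α / 4 := by ring
  calc gaussianMoment (offAxisNormSq z) α
      ≤ Real.exp (-(Real.pi * (α - α / 2) * z.im)) * gaussianMoment (offAxisNormSq z) (α / 2) :=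
        (gaussianSummable_offAxisNormSq z).gaussianMoment_le_exp_mul
          (fun p _ => im_le_offAxisNormSq z p) (half_pos hα) (half_le_self hα.le)
    _ ≤ Real.exp (-(Real.pi * (α - α / 2) * z.im)) * gaussianMoment (latticeNormSq z) (α / 2) := by
        gcongr
        exact hQ.gaussianMoment_comp_le Subtype.val_injective (half_pos hα)
    _ ≤ Real.exp (-(Real.pi * (α - α / 2) * z.im)) *
          (2 / (Real.pi * (α / 2)) * gaussianSum (latticeNormSq z) (α / 4)) := by
        gcongr
        exact (hQ.gaussianMoment_le_gaussianSum (half_pos hα)).trans_eq (by rw [hquarter])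
    _ ≤ _ := by
        rw [sub_half]
        gcongr
        exact gaussianSum_latticeNormSq_le_of_one_le_im (by positivity) hz

theorem tendsto_im_atImInfty : Tendsto UpperHalfPlane.im atImInfty atTop :=
  tendsto_comap

theorem tendsto_gaussianMoment_offAxisNormSq {α : ℝ} (hα : 0 < α) :
    Tendsto (fun z => gaussianMoment (offAxisNormSq z) α) atImInfty (𝓝 0) := by
  have hdecay := ((tendsto_rpow_mul_exp_neg_mul_atTop_nhds_zero (1 / 2)
    (Real.pi * (α / 2) * (α / 4)) (by positivity)).comp
      (tendsto_im_atImInfty.atTop_div_const (show 0 < α / 4 by positivity))).const_mul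
        (2 / (Real.pi * (α / 2)) * (gaussianSum intSq (α / 4) * gaussianSum intSq (α / 4)⁻¹))
  rw [mul_zero] at hdecay
  refine squeeze_zero' (.of_forall fun z =>
    (gaussianSummable_offAxisNormSq z).gaussianMoment_nonneg α) ?_ hdecay
  filter_upwards [tendsto_im_atImInfty.eventually_ge_atTop 1] with z hz
  refine (gaussianMoment_offAxisNormSq_le hα hz).trans_eq ?_
  have hexp : -(Real.pi * (α / 2) * z.im) = -(Real.pi * (α / 2) * (α / 4)) * (z.im / (α / 4)) := by
    field_simp
  rw [Function.comp_apply, ← Real.sqrt_eq_rpow, hexp]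
  ring

theorem tendsto_latticeK_sub_sqrt {α : ℝ} (hα : 0 < α) :
    Tendsto (fun z : ℍ => latticeK α z - √(z.im / α) / (2 * Real.pi * α)) atImInfty (𝓝 0) := by
  have haxis := (tendsto_gaussianMoment_intSq_inv_div.comp
    (tendsto_im_atImInfty.atTop_div_const hα)).const_mul α⁻¹
  have hlim := haxis.add (tendsto_gaussianMoment_offAxisNormSq hα)
  rw [mul_zero, zero_add] at hlim
  refine hlim.congr fun z => ?_
  rw [latticeK_eq_add hα, Function.comp_apply, inv_div]
  field_simp
  ring

theorem tendsto_latticeK_atTop {α : ℝ} (hα : 0 < α) : Tendsto (latticeK α) atImInfty atTop := by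
  have hmain : Tendsto (fun z : ℍ => √(z.im / α) / (2 * Real.pi * α)) atImInfty atTop :=
    (Real.tendsto_sqrt_atTop.comp (tendsto_im_atImInfty.atTop_div_const hα)).atTop_div_const
      (by positivity)
  exact ((tendsto_latticeK_sub_sqrt hα).add_atTop hmain).congr fun z => sub_add_cancel _ _

theorem tendsto_latticeEnergy_two_mul_sqrt_two {α : ℝ} (hα : 0 < α) :
    Tendsto (latticeEnergy α (2 * √2)) atImInfty (𝓝 0) := by
  have hlim := (tendsto_latticeK_sub_sqrt hα).sub
    ((tendsto_latticeK_sub_sqrt (mul_pos two_pos hα)).const_mul (2 * √2))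
  rw [mul_zero, sub_zero] at hlim
  refine hlim.congr fun z => ?_
  have hsqrt : √(z.im / α) = √2 * √(z.im / (2 * α)) := by
    rw [← Real.sqrt_mul two_pos.le]
    congr 1
    field_simp
  rw [latticeEnergy, hsqrt]
  field_simp
  ring

theorem tendsto_latticeEnergy_atBot {α b : ℝ} (hα : 0 < α) (hb : 2 * √2 < b) :
    Tendsto (latticeEnergy α b) atImInfty atBot := by
  have hK := (tendsto_latticeK_atTop (mul_pos two_pos hα)).const_mul_atTop_of_neg
    (sub_neg.mpr hb)
  refine ((tendsto_latticeEnergy_two_mul_sqrt_two hα).add_atBot hK).congr fun z => ?_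
  rw [latticeEnergy, latticeEnergy]
  ring

end CuspExpansion

section Positivity

theorem latticeEnergy_pos_of_half_le_mul_im {α : ℝ} (hα : 0 < α) {z : ℍ}
    (hαz : 1 / 2 ≤ α * z.im) : 0 < latticeEnergy α (2 * √2) z := by
  have haxis : 2 * √2 * (gaussianMoment intSq (2 * α / z.im) / z.im) <
      gaussianMoment intSq (α / z.im) / z.im := by
    rw [mul_div_assoc 2 α, ← mul_div_assoc]
    exact div_lt_div_of_pos_right
      (gaussianMoment_intSq_doubling_lt (div_pos hα z.im_pos)) z.im_pos
  have hoff : 2 * √2 * gaussianMoment (offAxisNormSq z) (2 * α) <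
      gaussianMoment (offAxisNormSq z) α := by
    refine (gaussianSummable_offAxisNormSq z).mul_gaussianMoment_two_mul_lt (by positivity) hα
      (fun p _ => log_two_mul_sqrt_two_lt.trans ?_)
      ⟨⟨(1, 0), one_ne_zero⟩, (z.im_pos.trans_le (im_le_offAxisNormSq z _)).ne'⟩
    calc (3 / 2 : ℝ) < Real.pi * (1 / 2) := by linarith [Real.pi_gt_three]
      _ ≤ Real.pi * (α * offAxisNormSq z p) := by
        gcongr
        exact hαz.trans (by gcongr; exact im_le_offAxisNormSq z p)
      _ = Real.pi * α * offAxisNormSq z p := (mul_assoc _ _ _).symm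
  rw [latticeEnergy, latticeK_eq_add hα, latticeK_eq_add (mul_pos two_pos hα)]
  linarith

theorem latticeEnergy_pos_of_mul_im_le_half {α : ℝ} (hα : 0 < α) {z : ℍ}
    (hαz : α * z.im ≤ 1 / 2) (hz : 3 ≤ 4 * z.im ^ 2) : 0 < latticeEnergy α (2 * √2) z := by
  have hQ := gaussianSummable_latticeNormSq z
  have hy := z.im_pos
  have hmin : 3 / 2 * α ≤ min z.im z.im⁻¹ := by
    rw [le_min_iff, ← one_div, le_div_iff₀ hy]
    constructor <;> nlinarith
  have hlarge (p : ℤ × ℤ) (hp : latticeNormSq z p ≠ 0) :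
      (1 + 1 : ℝ) ≤ Real.pi * latticeNormSq z p / (2 * α) := by
    have hp0 : p ≠ 0 := by
      rintro rfl
      simp [latticeNormSq] at hp
    have := hmin.trans (min_im_inv_le_latticeNormSq z hp0)
    rw [le_div_iff₀ (by positivity)]
    nlinarith [Real.pi_gt_three]
  have hne : ∃ p, latticeNormSq z p ≠ 0 :=
    ⟨(1, 0), (hy.trans_le (im_le_latticeNormSq z one_ne_zero)).ne'⟩
  have hfour := (isThetaDual_latticeNormSq z).two_rpow_mul_gaussianMoment_two_mul_lt hQ hQ hα
    hlarge hne
  have hsqrt : 2 * √2 ≤ 2 ^ (1 + 1 : ℝ) := by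
    have hle : √2 ≤ 2 := Real.sqrt_le_iff.mpr (by norm_num)
    calc 2 * √2 ≤ 2 * 2 := by gcongr
      _ = 2 ^ (1 + 1 : ℝ) := by norm_num
  rw [latticeEnergy, latticeK_eq_gaussianMoment, latticeK_eq_gaussianMoment, sub_pos]
  exact (mul_le_mul_of_nonneg_right hsqrt (hQ.gaussianMoment_nonneg _)).trans_lt hfour

theorem latticeEnergy_pos {α : ℝ} (hα : 0 < α) (z : ℍ) : 0 < latticeEnergy α (2 * √2) z := by
  obtain ⟨g, hg⟩ := ModularGroup.exists_smul_mem_fd z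
  rw [← latticeEnergy_smul _ _ g]
  rcases le_total (1 / 2) (α * (g • z).im) with h | h
  · exact latticeEnergy_pos_of_half_le_mul_im hα h
  · exact latticeEnergy_pos_of_mul_im_le_half hα h
      (ModularGroup.three_le_four_mul_im_sq_of_mem_fd hg)

end Positivity

theorem exists_latticeEnergy_lt {α b : ℝ} (hα : 0 < α) (hb : 2 * √2 ≤ b) (z₀ : ℍ) :
    ∃ z, latticeEnergy α b z < latticeEnergy α b z₀ := by
  rcases hb.eq_or_lt with rfl | hb
  · exact ((tendsto_latticeEnergy_two_mul_sqrt_two hα).eventually_lt_const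
      (latticeEnergy_pos hα z₀)).exists
  · exact ((tendsto_latticeEnergy_atBot hα hb).eventually_lt_atBot _).exists

theorem proposition5p1_general (α : ℝ) (hα : 0 < α) :
    (∀ b : ℝ, 2 * √2 ≤ b → ¬ ∃ z₀ : ℍ, IsMinOn (latticeEnergy α b) Set.univ z₀) ∧
    (∀ b : ℝ, 2 * √2 < b → Tendsto (latticeEnergy α b) atImInfty atBot) ∧
    Tendsto (latticeEnergy α (2 * √2)) atImInfty (𝓝[>] 0) ∧
    (∀ z : ℍ, 0 < latticeEnergy α (2 * √2) z) := by
  refine ⟨?_, fun b => tendsto_latticeEnergy_atBot hα,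
    tendsto_nhdsWithin_iff.mpr ⟨tendsto_latticeEnergy_two_mul_sqrt_two hα,
      .of_forall (latticeEnergy_pos hα)⟩,
    latticeEnergy_pos hα⟩
  rintro b hb ⟨z₀, hz₀⟩
  obtain ⟨z, hz⟩ := exists_latticeEnergy_lt hα hb z₀
  exact hz.not_ge (hz₀ (Set.mem_univ z))

theorem proposition5p1 (α : ℝ) (hα : 2 ≤ α) :
    (∀ b : ℝ, 2 * Real.sqrt 2 ≤ b →
      ¬ ∃ z₀ : ℍ, IsMinOn (latticeEnergy α b) Set.univ z₀) ∧
    (∀ b : ℝ, 2 * Real.sqrt 2 < b →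
      Tendsto (latticeEnergy α b) UpperHalfPlane.atImInfty atBot) ∧
    Tendsto (latticeEnergy α (2 * Real.sqrt 2)) UpperHalfPlane.atImInfty (𝓝[>] 0) ∧
    (∀ z ∈ GammaC, 0 < latticeEnergy α (2 * Real.sqrt 2) z) := by
  obtain ⟨hmin, hbot, hzero, hpos⟩ := proposition5p1_general α (two_pos.trans_le hα)
  exact ⟨hmin, hbot, hzero, fun z _ => hpos z⟩
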